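/- For $n\ge 1$ let $\mathcal A_n=\{H_I \mid \emptyset\ne I\subseteq[n]\}$ be the resonance arrangement in $\mathbb R^n$, where $H_I=\{x\in\mathbb R^n : \sum_{j\in I}x_j=0\}$. For an arrangement $\mathcal A$ of linear hyperplanes in $\mathbb R^n$ let $\chi(\mathcal A;t)=\sum_{S\subseteq\mathcal A}(-1)^{|S|}t^{r(\mathcal A)-r(S)}$, where $r(S)=\operatorname{codim}\bigcap_{H\in S}H$, and let the $i$-th Betti number $b_i(\mathcal A)$ be the absolute value of the coefficient of $t^{n-i}$ in $\chi(\mathcal A;t)$ (so it is $0$ for $i>n$). Let $S(n,k)$ denote the Stirling numbers of the second kind. A circuit of $\mathcal A_n$ is a minimally dependent subset, where $S\subseteq\mathcal A_n$ is dependent if $r(S)<|S|$. A broken circuit is a circuit with its largest hyperplane removed, where the hyperplanes $H_I$ are ordered by the binary numbers $\sum_{j\in I}2^j$. An $(i,k)$-prototype is an injective map $f:[k-1]\to\mathcal P([i])\setminus\{\emptyset\}$. Given such an $f$ and a partition of $[n+1]$ into $k$ non-empty blocks $P_1,\dots,P_k$, listed in increasing order of their binary numbers (so that $n+1\in P_k$),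 put $A_j=\bigcup_{\ell\in[k-1],\, j\in f(\ell)}P_\ell\subseteq[n]$ for $1\le j\le i$. The prototype $f$ is called functional if for every $n\ge1$ and every partition of $[n+1]$ into $k$ non-empty blocks the sets $A_1,\dots,A_i$ are non-empty and pairwise different and $\{H_{A_1},\dots,H_{A_i}\}$ contains no broken circuit of $\mathcal A_n$. Theorem. There exist positive integers $c_{i,k}$, for all $i\ge 0$ and $i+1\le k\le 2^i$, such that for all $i\ge 0$ and $n\ge 1$ $$b_i(\mathcal A_n)=\sum_{k=i+1}^{2^i}c_{i,k}\,S(n+1,k).$$ Moreover, for all $i\ge0$ and $i+1\le k\le 2^i$, $$c_{i,k}\le\binom{2^i-1}{k-1}\frac{(k-1)!}{i!}\qquad\text{and}\qquad c_{i,k}=\frac{|\{\text{functional }(i,k)\text{-prototypes}\}|}{i!}.$$ -/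

import Mathlib

/-- The rank `r(S)`: the codimension of the intersection of the hyperplanes in `S`. -/
noncomputable def arrRank {K : Type*} [Field K] {n : ℕ}
    (S : Finset (Submodule K (Fin n → K))) : ℕ :=
  Module.finrank K ((Fin n → K) ⧸ S.inf id)

/-- The characteristic polynomial `∑_{S ⊆ A} (-1)^|S| t^(r(A) - r(S))` of an arrangement `A` of
linear hyperplanes in `K^n`. (Here `r(S) ≤ r(A)`, so the exponent is an honest difference.) -/
noncomputable def charPoly {K : Type*} [Field K] {n : ℕ}
    (A : Finset (Submodule K (Fin n → K))) : Polynomial ℤ :=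
  ∑ S ∈ A.powerset, (-1) ^ S.card * Polynomial.X ^ (arrRank A - arrRank S)

/-- The `i`-th Betti number: the absolute value of the coefficient of `t^(n-i)` in the
characteristic polynomial (it is zero if `n - i` is negative). -/
noncomputable def bettiNumber {K : Type*} [Field K] {n : ℕ}
    (A : Finset (Submodule K (Fin n → K))) (i : ℕ) : ℕ :=
  if i ≤ n then ((charPoly A).coeff (n - i)).natAbs else 0

/-- The hyperplane `H_I = {∑_{i ∈ I} x_i = 0}` in `ℝ^n`; the ground set `[n]` is `Fin n`. -/
noncomputable def resHyperplane {n : ℕ} (I : Finset (Fin n)) : Submodule ℝ (Fin n → ℝ) :=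
  LinearMap.ker (∑ i ∈ I, (LinearMap.proj i : (Fin n → ℝ) →ₗ[ℝ] ℝ))

open Classical in
/-- The resonance arrangement `A_n = {H_I | ∅ ≠ I ⊆ [n]}`. -/
noncomputable def resonanceArr (n : ℕ) : Finset (Submodule ℝ (Fin n → ℝ)) :=
  (Finset.univ.filter (fun I : Finset (Fin n) => I.Nonempty)).image resHyperplane

/-- A circuit of an arrangement: a minimally dependent subset, where a set of hyperplanes is
dependent if the codimension of its intersection is less than its cardinality. -/
def IsCircuit {K : Type*} [Field K] {n : ℕ} (A C : Finset (Submodule K (Fin n → K))) : Prop :=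
  C ⊆ A ∧ arrRank C < C.card ∧ ∀ D, D ⊂ C → ¬ arrRank D < D.card

open Classical in
/-- A broken circuit of `A` with respect to the order `lt` on its hyperplanes: a circuit without
its largest element. -/
def IsBrokenCircuit {K : Type*} [Field K] {n : ℕ} (A : Finset (Submodule K (Fin n → K)))
    (lt : Submodule K (Fin n → K) → Submodule K (Fin n → K) → Prop)
    (B : Finset (Submodule K (Fin n → K))) : Prop :=
  ∃ C H, IsCircuit A C ∧ H ∈ C ∧ (∀ H' ∈ C, H' ≠ H → lt H' H) ∧ B = C.erase H

/-- The binary number encoding a finite set of labels. -/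
def binCode {n : ℕ} (I : Finset (Fin n)) : ℕ := ∑ x ∈ I, 2 ^ (x : ℕ)

/-- The order on the hyperplanes of the resonance arrangement given by the binary numbers of the
defining subsets. -/
def resLT {n : ℕ} (H H' : Submodule ℝ (Fin n → ℝ)) : Prop :=
  ∃ I J : Finset (Fin n), I.Nonempty ∧ J.Nonempty ∧ H = resHyperplane I ∧ H' = resHyperplane J ∧
    binCode I < binCode J

/-- `(i,k)`-prototypes: injective maps `[k-1] → P([i]) \ {∅}`. -/
def IsPrototype (i k : ℕ) (f : Fin (k - 1) → Finset (Fin i)) : Prop :=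
  Function.Injective f ∧ ∀ l, (f l).Nonempty

/-- `P` lists the blocks `P_1 < ⋯ < P_k` of the partition `p` of `[n+1]` in the order of their
binary numbers; in particular `p` has exactly `k` blocks, and `n + 1` (that is, `Fin.last n`)
lies in `P_k`. -/
def IsOrderedBlocks {n k : ℕ} (p : Finpartition (Finset.univ : Finset (Fin (n + 1))))
    (P : Fin k → Finset (Fin (n + 1))) : Prop :=
  Finset.univ.image P = p.parts ∧ StrictMono (fun l => binCode (P l))

/-- The tuple of subsets of `[n]` given by a prototype and the ordered blocks of a partition of
`[n+1]`: `A_j` is the union of those `P_l` with `l ∈ [k-1]` and `j ∈ f l`. As `n + 1` lies in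
`P_k`, this union is contained in `[n]`, which `Fin.castSucc` embeds in `[n+1]`. -/
def protoTuple {i k n : ℕ} (f : Fin (k - 1) → Finset (Fin i)) (P : Fin k → Finset (Fin (n + 1)))
    (j : Fin i) : Finset (Fin n) :=
  Finset.univ.filter (fun x => ∃ l : Fin (k - 1), j ∈ f l ∧
    x.castSucc ∈ P (Fin.castLE (Nat.sub_le k 1) l))

open Classical in
/-- Functional prototypes: for all partitions of `[n+1]` into `k` blocks, the resulting tuple
consists of `i` pairwise different non-empty subsets of `[n]`, and the corresponding set of
hyperplanes of the resonance arrangement contains no broken circuit. -/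
def IsFunctional (i k : ℕ) (f : Fin (k - 1) → Finset (Fin i)) : Prop :=
  IsPrototype i k f ∧
    ∀ (n : ℕ), 1 ≤ n → ∀ (p : Finpartition (Finset.univ : Finset (Fin (n + 1))))
      (P : Fin k → Finset (Fin (n + 1))), IsOrderedBlocks p P →
      Function.Injective (protoTuple f P) ∧ (∀ j, (protoTuple f P j).Nonempty) ∧
      ∀ B ⊆ Finset.univ.image (fun j => resHyperplane (protoTuple f P j)),
        ¬ IsBrokenCircuit (resonanceArr n) resLT B

/-!
The proof counts ordered tuples `(A_1, …, A_i)` of pairwise different non-empty subsets of `[n]`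
whose hyperplanes contain no broken circuit, in two ways.

By Whitney's theorem (`sum_neg_one_pow_card_eq_card_isNBC`), applied to the `0`-`1` normal vectors of
the resonance arrangement, there are `i! * b_i(A_n)` of them (`card_isNBCTuple`).

On the other hand, sending `x ∈ [n + 1]` to the set of those `j` with `x ∈ A_j` (and `n + 1` to `∅`)
is a map which factors uniquely as a labelling of `[n + 1]`, whose labels are ordered by the largest
elements of their blocks, followed by an injective map of the labels. The labelling is a partition
into `k` blocks, and there are `S(n + 1, k)` of them (`card_isBlockOrdered`); the injective map is an
`(i, k)`-prototype. Which prototypes occur does not depend on the partition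
(`isNBCTuple_unionBlocks_iff`): a `0`-`1` vector in the span of unions of blocks is again the vector
of a union of blocks, and unions of blocks compare like the sets of their labels because binary
numbers compare colexicographically. So the tuples are counted by functional prototypes times
Stirling numbers (`card_isNBCTuple_eq_sum`), where linear independence forces `k - 1 ≥ i`.

The number of functional prototypes is divisible by `i!`, because being functional depends only on
the set of the `A_j` (`factorial_dvd_card_isFunctional`). It is positive for `i + 1 ≤ k ≤ 2 ^ i`,
because any prototype whose last `i` values are `{1, …, i} ⊃ {2, …, i} ⊃ ⋯ ⊃ {i}` is functional
(`isNBCTuple_of_staircase`).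
-/

/-! ### Sets without broken circuits and Whitney's theorem -/

section Whitney

variable {K V α : Type*} [Field K] [AddCommGroup V] [Module K V]

variable (K) in
/-- For vectors `v` labelled by `α` and ordered by `c`, this is the span of the members of `s`
which are smaller than `x`. -/
def spanBelow (v : α → V) (c : α → ℕ) (s : Finset α) (x : α) : Submodule K V :=
  Submodule.span K (v '' {y | y ∈ s ∧ c y < c x})

variable (K) in
/-- A set `s` contains no broken circuit of the vector configuration `v` on the ground set `U` (with
`c` as order) if no vector of the ground set is a combination of smaller members of `s`. This
phrasing avoids circuits; see `exists_circuit_of_mem_spanBelow` for the link. -/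
def IsNBC (v : α → V) (c : α → ℕ) (U s : Finset α) : Prop :=
  ∀ x ∈ U, v x ∉ spanBelow K v c s x

variable {v : α → V} {c : α → ℕ} {U s : Finset α}

theorem spanBelow_mono {t : Finset α} (h : s ⊆ t) (x : α) :
    spanBelow K v c s x ≤ spanBelow K v c t x :=
  Submodule.span_mono (Set.image_mono fun _ hy => ⟨h hy.1, hy.2⟩)

theorem IsNBC.mono {t : Finset α} (ht : IsNBC K v c U t) (h : s ⊆ t) : IsNBC K v c U s :=
  fun x hx hm => ht x hx (spanBelow_mono h x hm)

/-- Adding the vectors in increasing order, each one is independent of the previous ones. -/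
theorem IsNBC.linearIndepOn (hs : IsNBC K v c U s) (hsU : s ⊆ U)
    (hc : Set.InjOn c s) : LinearIndepOn K v (s : Set α) := by
  classical
  induction s using Finset.induction_on_max_value c with
  | empty => simp
  | insert a s ha hmax ih =>
    have hsub : s ⊆ insert a s := Finset.subset_insert a s
    rw [Finset.coe_insert, linearIndepOn_insert (by simpa using ha)]
    refine ⟨ih (hs.mono hsub) (hsub.trans hsU) (hc.mono (by exact_mod_cast hsub)), fun h => ?_⟩
    refine hs a (hsU (Finset.mem_insert_self a s)) (Submodule.span_mono (Set.image_mono ?_) h)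
    intro y hy
    refine ⟨hsub hy, lt_of_le_of_ne (hmax y hy) fun h => ha ?_⟩
    rwa [← hc (hsub hy) (Finset.mem_insert_self a s) h]

theorem linearIndepOn_iff_finrank_span_eq_card (s : Finset α) :
    LinearIndepOn K v (s : Set α) ↔ Module.finrank K (Submodule.span K (v '' s)) = s.card := by
  rw [LinearIndepOn, linearIndependent_iff_card_eq_finrank_span, Set.finrank, eq_comm,
    Set.image_eq_range]
  simp

theorem finrank_span_image_le_card (s : Finset α) :
    Module.finrank K (Submodule.span K (v '' s)) ≤ s.card := by
  classical
  rw [← Finset.coe_image]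
  exact (finrank_span_finset_le_card _).trans Finset.card_image_le

/-- Any element of a circuit is spanned by the others; for the largest one these form the broken
circuit. -/
theorem mem_span_erase_of_circuit [DecidableEq α] {C : Finset α} {x : α} (hx : x ∈ C)
    (hdep : ¬ LinearIndepOn K v (C : Set α))
    (hmin : ∀ D ⊂ C, LinearIndepOn K v (D : Set α)) :
    v x ∈ Submodule.span K (v '' (C.erase x : Finset α)) := by
  by_contra h
  refine hdep ?_
  rw [← Finset.insert_erase hx, Finset.coe_insert, linearIndepOn_insert (by simp)]
  exact ⟨hmin _ (Finset.erase_ssubset hx), h⟩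

/-- A subset of `s` which is minimal among those spanning `x` from below is a broken circuit. -/
theorem exists_circuit_of_mem_spanBelow [DecidableEq α] {x : α}
    (hx : v x ∈ spanBelow K v c s x) :
    ∃ R ⊆ s, (∀ y ∈ R, c y < c x) ∧ ¬ LinearIndepOn K v (insert x R : Finset α) ∧
      ∀ D ⊂ insert x R, LinearIndepOn K v (D : Set α) := by
  obtain ⟨R, hRs, hR⟩ := exists_minimal_le_of_wellFoundedLT
    (fun R : Finset α => v x ∈ Submodule.span K (v '' R)) (s.filter fun y => c y < c x)
    (by simpa [spanBelow] using hx)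
  have hlt : ∀ y ∈ R, c y < c x := fun y hy => (Finset.mem_filter.1 (hRs hy)).2
  have hxR : x ∉ R := fun h => lt_irrefl _ (hlt x h)
  have hmin : ∀ D ⊂ R, v x ∉ Submodule.span K (v '' D) := fun D hD h => hD.2 (hR.2 h hD.1)
  have hRind : LinearIndepOn K v (R : Set α) := by
    rw [linearIndepOn_iff_notMem_span]
    intro y hy hspan
    refine hmin (R.erase y) (Finset.erase_ssubset hy) ?_
    have hle : Submodule.span K (v '' R) ≤ Submodule.span K (v '' (R.erase y : Finset α)) := by
      rw [Submodule.span_le]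
      rintro _ ⟨z, hz, rfl⟩
      by_cases hzy : z = y
      · subst hzy; simpa using hspan
      · exact Submodule.subset_span ⟨z, by simpa [hzy] using hz, rfl⟩
    exact hle hR.1
  refine ⟨R, hRs.trans (Finset.filter_subset _ _), hlt, fun h => ?_, fun D hD => ?_⟩
  · rw [Finset.coe_insert, linearIndepOn_insert (by simpa using hxR)] at h
    exact h.2 hR.1
  · by_cases hxD : x ∈ D
    · have hDR : D.erase x ⊂ R := by
        rw [Finset.ssubset_iff_subset_ne]
        refine ⟨Finset.subset_insert_iff.1 hD.1, fun h => hD.2 ?_⟩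
        rw [← h, Finset.insert_erase hxD]
      rw [← Finset.insert_erase hxD, Finset.coe_insert, linearIndepOn_insert (by simp)]
      exact ⟨hRind.mono (by exact_mod_cast hDR.1), hmin _ hDR⟩
    · exact hRind.mono (by exact_mod_cast (Finset.subset_insert_iff_of_notMem hxD).1 hD.1)

theorem spanBelow_le (s : Finset α) (x : α) :
    spanBelow K v c s x ≤ Submodule.span K (v '' s) :=
  Submodule.span_mono (Set.image_mono fun _ h => h.1)

section Toggle

variable [DecidableEq α]

theorem span_image_insert_eq {s : Finset α} {x : α} (hx : v x ∈ Submodule.span K (v '' s)) :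
    Submodule.span K (v '' (insert x s : Finset α)) = Submodule.span K (v '' s) := by
  rw [Finset.coe_insert, Set.image_insert_eq, Submodule.span_insert_eq_span hx]

/-- Adding an element which is spanned from below changes none of the spans from below. -/
theorem spanBelow_insert {x : α} (hx : v x ∈ spanBelow K v c s x) (y : α) :
    spanBelow K v c (insert x s) y = spanBelow K v c s y := by
  refine le_antisymm ?_ (spanBelow_mono (Finset.subset_insert x s) y)
  refine Submodule.span_le.2 ?_
  rintro _ ⟨z, ⟨hz, hzy⟩, rfl⟩
  rcases Finset.mem_insert.1 hz with rfl | hz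
  · exact Submodule.span_mono (Set.image_mono fun w (hw : w ∈ s ∧ c w < c z) =>
      (⟨hw.1, hw.2.trans hzy⟩ : w ∈ s ∧ c w < c y)) hx
  · exact Submodule.subset_span ⟨z, ⟨hz, hzy⟩, rfl⟩

theorem spanBelow_erase_self (x : α) : spanBelow K v c (s.erase x) x = spanBelow K v c s x := by
  unfold spanBelow
  congr 2
  ext y
  simp only [Finset.mem_erase, Set.mem_ofPred_eq]
  exact ⟨fun h => ⟨h.1.2, h.2⟩, fun h => ⟨⟨fun e => lt_irrefl _ (e ▸ h.2), h.1⟩, h.2⟩⟩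

/-- The set `s` with the membership of `x` switched. -/
def toggle (x : α) (s : Finset α) : Finset α := if x ∈ s then s.erase x else insert x s

theorem toggle_toggle (x : α) (s : Finset α) : toggle x (toggle x s) = s := by
  unfold toggle
  split_ifs with h1 h2 h2 <;> simp_all

theorem spanBelow_toggle {x : α} (hx : v x ∈ spanBelow K v c s x) (y : α) :
    spanBelow K v c (toggle x s) y = spanBelow K v c s y := by
  unfold toggle
  split_ifs with h
  · rw [← spanBelow_erase_self] at hx
    rw [← spanBelow_insert hx, Finset.insert_erase h]
  · exact spanBelow_insert hx y

theorem span_toggle {x : α} (hx : v x ∈ spanBelow K v c s x) :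
    Submodule.span K (v '' (toggle x s : Finset α)) = Submodule.span K (v '' s) := by
  unfold toggle
  split_ifs with h
  · rw [← spanBelow_erase_self] at hx
    rw [← span_image_insert_eq (spanBelow_le _ _ hx), Finset.insert_erase h]
  · exact span_image_insert_eq (spanBelow_le _ _ hx)

theorem neg_one_pow_card_toggle (x : α) (s : Finset α) :
    (-1 : ℤ) ^ (toggle x s).card = -(-1) ^ s.card := by
  unfold toggle
  split_ifs with h
  · rw [← Finset.card_erase_add_one h, pow_succ]; ring
  · rw [Finset.card_insert_of_notMem h, pow_succ]; ring

end Toggle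

open Classical in
/-- **Whitney's broken circuit theorem.** The sets containing a broken circuit cancel: the set of
elements spanned from below is unchanged if one of these elements is toggled, so that toggling an
element chosen from this set is a sign-reversing, rank-preserving involution. -/
theorem sum_neg_one_pow_card_eq_card_isNBC (hc : Set.InjOn c U) (i : ℕ) :
    ∑ s ∈ U.powerset with Module.finrank K (Submodule.span K (v '' (s : Finset α))) = i,
      (-1 : ℤ) ^ s.card =
      (-1) ^ i * ((U.powersetCard i).filter (IsNBC K v c U)).card := by
  rw [← Finset.sum_filter_add_sum_filter_not _ (IsNBC K v c U)]
  have h1 : (U.powerset.filter fun s =>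
      Module.finrank K (Submodule.span K (v '' (s : Finset α))) = i).filter (IsNBC K v c U) =
      (U.powersetCard i).filter (IsNBC K v c U) := by
    ext s
    simp only [Finset.mem_filter, Finset.mem_powerset, Finset.mem_powersetCard]
    have key : s ⊆ U → IsNBC K v c U s →
        Module.finrank K (Submodule.span K (v '' (s : Finset α))) = s.card := fun hsU hs =>
      (linearIndepOn_iff_finrank_span_eq_card s).1
        (hs.linearIndepOn hsU (hc.mono (by exact_mod_cast hsU)))
    constructor
    · rintro ⟨⟨hsU, hi⟩, hs⟩
      exact ⟨⟨hsU, by rw [← key hsU hs, hi]⟩, hs⟩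
    · rintro ⟨⟨hsU, hi⟩, hs⟩
      exact ⟨⟨hsU, by rw [key hsU hs, hi]⟩, hs⟩
  rw [h1, Finset.sum_congr rfl (g := fun _ => (-1 : ℤ) ^ i), Finset.sum_const, nsmul_eq_mul,
    mul_comm, add_eq_left]
  · let D : Finset α → Finset α := fun s => U.filter fun x => v x ∈ spanBelow K v c s x
    have hD : ∀ s, ¬ IsNBC K v c U s → (D s).Nonempty := by
      intro s hs
      simp only [IsNBC, not_forall, not_not] at hs
      obtain ⟨x, hxU, hx⟩ := hs
      exact ⟨x, Finset.mem_filter.2 ⟨hxU, hx⟩⟩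
    -- The toggled element is chosen from `D s` alone, so that the same element is toggled back.
    let pick : Finset α → Finset α → Finset α := fun d s =>
      if h : d.Nonempty then toggle h.choose s else s
    have hpick : ∀ s, ∀ h : (D s).Nonempty, pick (D s) s = toggle h.choose s := fun s h => by
      simp only [pick, h, dif_pos]
    have hDpick : ∀ s, (D s).Nonempty → D (pick (D s) s) = D s := by
      intro s h
      rw [hpick s h]
      have hx := (Finset.mem_filter.1 h.choose_spec).2
      ext y
      simp only [D, Finset.mem_filter]
      rw [spanBelow_toggle hx]
    refine Finset.sum_involution (fun s _ => pick (D s) s) ?_ ?_ ?_ ?_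
    · intro s hs
      rw [hpick s (hD s (Finset.mem_filter.1 hs).2), neg_one_pow_card_toggle]
      ring
    · intro s hs _ h
      have h2 := neg_one_pow_card_toggle (hD s (Finset.mem_filter.1 hs).2).choose s
      rw [← hpick, h] at h2
      have : (-1 : ℤ) ^ s.card ≠ 0 := pow_ne_zero _ (by norm_num)
      omega
    · intro s hs
      simp only [Finset.mem_filter, Finset.mem_powerset] at hs ⊢
      have hne := hD s hs.2
      have hx := Finset.mem_filter.1 hne.choose_spec
      refine ⟨⟨?_, ?_⟩, fun h => ?_⟩
      · rw [hpick s hne]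
        unfold toggle
        split_ifs
        · exact (Finset.erase_subset _ _).trans hs.1.1
        · exact Finset.insert_subset hx.1 hs.1.1
      · rw [hpick s hne, span_toggle hx.2, hs.1.2]
      · refine h _ hx.1 ?_
        rw [hpick s hne, spanBelow_toggle hx.2]
        exact hx.2
    · intro s hs
      have hne := hD s (Finset.mem_filter.1 hs).2
      change pick (D (pick (D s) s)) (pick (D s) s) = s
      rw [hDpick s hne, hpick s hne]
      simp only [pick, hne, dif_pos, toggle_toggle]
  · intro s hs
    rw [(Finset.mem_powersetCard.1 (Finset.mem_filter.1 hs).1).2]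

end Whitney

/-! ### The resonance arrangement as a vector configuration -/

/-- The `0`-`1` vector of a set of labels, which is a normal vector of the hyperplane
`resHyperplane I`. -/
def indVec {n : ℕ} (I : Finset (Fin n)) : Fin n → ℝ := fun x => if x ∈ I then 1 else 0

theorem indVec_injective {n : ℕ} : Function.Injective (indVec (n := n)) := by
  intro I J h
  ext x
  have := congrFun h x
  simp only [indVec] at this
  by_cases h1 : x ∈ I <;> by_cases h2 : x ∈ J <;> simp_all

theorem indVec_eq_zero_iff {n : ℕ} {I : Finset (Fin n)} : indVec I = 0 ↔ I = ∅ := by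
  rw [← indVec_injective.eq_iff]
  have : indVec (∅ : Finset (Fin n)) = 0 := by ext; simp [indVec]
  rw [this]

theorem binCode_eq_geomSum {n : ℕ} (I : Finset (Fin n)) :
    binCode I = ∑ x ∈ I.map Fin.valEmbedding, 2 ^ x := by
  simp [binCode]

/-- Binary numbers compare colexicographically. -/
theorem binCode_lt_iff {n : ℕ} {I J : Finset (Fin n)} :
    binCode I < binCode J ↔ ∃ a ∈ J, a ∉ I ∧ ∀ b ∈ I, b ∉ J → b < a := by
  rw [binCode_eq_geomSum, binCode_eq_geomSum,
    Finset.geomSum_lt_geomSum_iff_toColex_lt_toColex le_rfl, Finset.map_eq_image,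
    Finset.map_eq_image]
  exact (Finset.Colex.toColex_image_lt_toColex_image Fin.val_strictMono).trans
    Finset.Colex.toColex_lt_toColex_iff_exists_forall_lt

theorem binCode_injective {n : ℕ} : Function.Injective (binCode (n := n)) := by
  intro I J h
  rw [binCode_eq_geomSum, binCode_eq_geomSum] at h
  exact Finset.map_injective _ (Finset.geomSum_injective le_rfl h)

theorem mem_resHyperplane {n : ℕ} {I : Finset (Fin n)} {x : Fin n → ℝ} :
    x ∈ resHyperplane I ↔ ∑ i ∈ I, x i = 0 := by
  simp [resHyperplane]

theorem subset_of_resHyperplane_eq {n : ℕ} {I J : Finset (Fin n)}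
    (h : resHyperplane I = resHyperplane J) : I ⊆ J := by
  intro x hx
  by_contra hxJ
  have hJ : Pi.single x (1 : ℝ) ∈ resHyperplane J := by
    rw [mem_resHyperplane]
    refine Finset.sum_eq_zero fun i hi => Pi.single_eq_of_ne ?_ _
    rintro rfl
    exact hxJ hi
  rw [← h, mem_resHyperplane] at hJ
  simp [Pi.single_apply, hx] at hJ

theorem resHyperplane_injective {n : ℕ} : Function.Injective (resHyperplane (n := n)) :=
  fun _ _ h => (subset_of_resHyperplane_eq h).antisymm (subset_of_resHyperplane_eq h.symm)

/-- The non-empty sets of labels, which index the resonance arrangement. -/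
def labelSets (n : ℕ) : Finset (Finset (Fin n)) := Finset.univ.filter (·.Nonempty)

theorem mem_labelSets {n : ℕ} {I : Finset (Fin n)} : I ∈ labelSets n ↔ I.Nonempty := by
  simp [labelSets]

/-- Row rank equals column rank: the codimension of an intersection of hyperplanes is the dimension
of the span of their normal vectors. -/
theorem arrRank_image_resHyperplane {n : ℕ} [DecidableEq (Submodule ℝ (Fin n → ℝ))]
    (s : Finset (Finset (Fin n))) :
    arrRank (s.image resHyperplane) =
      Module.finrank ℝ (Submodule.span ℝ (indVec '' (s : Set (Finset (Fin n))))) := by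
  let M : Matrix s (Fin n) ℝ := fun I => indVec I.1
  have hker : (s.image resHyperplane).inf id = LinearMap.ker M.mulVecLin := by
    ext x
    have hM : ∀ I : s, M.mulVecLin x I = ∑ j ∈ I.1, x j := fun I => by
      change ∑ j, indVec I.1 j * x j = _
      simp [indVec]
    simp only [Finset.inf_image, Function.id_comp, Submodule.mem_finsetInf, mem_resHyperplane,
      LinearMap.mem_ker, funext_iff, hM, Subtype.forall, Pi.zero_apply]
  rw [arrRank, hker, LinearEquiv.finrank_eq M.mulVecLin.quotKerEquivRange]
  have := M.rank_eq_finrank_span_row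
  rw [Matrix.rank] at this
  rw [this, Set.image_eq_range]
  rfl

theorem arrRank_lt_card_iff {n : ℕ} [DecidableEq (Submodule ℝ (Fin n → ℝ))]
    (s : Finset (Finset (Fin n))) :
    arrRank (s.image resHyperplane) < (s.image resHyperplane).card ↔
      ¬ LinearIndepOn ℝ indVec (s : Set (Finset (Fin n))) := by
  rw [linearIndepOn_iff_finrank_span_eq_card, arrRank_image_resHyperplane,
    Finset.card_image_of_injective _ resHyperplane_injective]
  exact (lt_iff_le_and_ne.trans (and_iff_right (finrank_span_image_le_card s)))

theorem resonanceArr_eq_image (n : ℕ) [DecidableEq (Submodule ℝ (Fin n → ℝ))] :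
    resonanceArr n = (labelSets n).image resHyperplane := by
  ext H
  simp [resonanceArr, labelSets]

theorem arrRank_resonanceArr (n : ℕ) : arrRank (resonanceArr n) = n := by
  classical
  rw [resonanceArr_eq_image, arrRank_image_resHyperplane]
  have : Submodule.span ℝ (indVec '' (labelSets n : Set (Finset (Fin n)))) = ⊤ := by
    rw [eq_top_iff, ← (Pi.basisFun ℝ (Fin n)).span_eq, Submodule.span_le]
    rintro _ ⟨j, rfl⟩
    refine Submodule.subset_span ⟨{j}, by simp [labelSets], ?_⟩
    ext x
    simp [indVec, Pi.single_apply]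
  rw [this, finrank_top]
  simp

theorem powerset_image_eq {α β : Type*} [DecidableEq β] (f : α → β) (U : Finset α) :
    (U.image f).powerset = U.powerset.image (Finset.image f) := by
  ext s
  simp only [Finset.mem_powerset, Finset.mem_image, Finset.subset_image_iff]

/-- The Betti numbers of the resonance arrangement count the sets without broken circuits. -/
theorem bettiNumber_resonanceArr (n i : ℕ) [DecidablePred
    (IsNBC ℝ (indVec (n := n)) binCode (labelSets n))] :
    bettiNumber (resonanceArr n) i = (((labelSets n).powersetCard i).filter
      (IsNBC ℝ indVec binCode (labelSets n))).card := by
  classical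
  by_cases hi : i ≤ n
  · have hle : ∀ s : Finset (Finset (Fin n)),
        Module.finrank ℝ (Submodule.span ℝ (indVec '' (s : Set (Finset (Fin n))))) ≤ n := fun s => by
      simpa using Submodule.finrank_le (Submodule.span ℝ (indVec '' (s : Set (Finset (Fin n)))))
    have hcoeff : (charPoly (resonanceArr n)).coeff (n - i) = ∑ s ∈ (labelSets n).powerset.filter
        (fun s : Finset (Finset (Fin n)) =>
          Module.finrank ℝ (Submodule.span ℝ (indVec '' (s : Set (Finset (Fin n))))) = i),
        (-1 : ℤ) ^ s.card := by
      rw [charPoly, arrRank_resonanceArr, Polynomial.finsetSum_coeff, resonanceArr_eq_image,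
        powerset_image_eq, Finset.sum_image fun _ _ _ _ h =>
          Finset.image_injective resHyperplane_injective h, Finset.sum_filter]
      refine Finset.sum_congr rfl fun s _ => ?_
      rw [arrRank_image_resHyperplane, Finset.card_image_of_injective _ resHyperplane_injective]
      have h1 : ((-1 : Polynomial ℤ)) ^ s.card = Polynomial.C ((-1) ^ s.card) := by simp
      rw [h1, Polynomial.coeff_C_mul_X_pow]
      have := hle s
      refine if_congr ?_ rfl rfl
      omega
    rw [bettiNumber, if_pos hi, hcoeff, sum_neg_one_pow_card_eq_card_isNBC
      (binCode_injective.injOn), Int.natAbs_mul, Int.natAbs_pow]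
    simp only [Int.reduceNeg, Int.natAbs_neg, Int.natAbs_one, one_pow, one_mul, Int.natAbs_natCast]
    congr!
  · rw [bettiNumber, if_neg hi, eq_comm, Finset.card_eq_zero, Finset.filter_eq_empty_iff]
    intro s hs h
    obtain ⟨hsU, hcard⟩ := Finset.mem_powersetCard.1 hs
    have := (linearIndepOn_iff_finrank_span_eq_card s).1
      (h.linearIndepOn hsU binCode_injective.injOn)
    have h2 := Submodule.finrank_le (Submodule.span ℝ (indVec '' (s : Set (Finset (Fin n)))))
    simp only [Module.finrank_fintype_fun_eq_card, Fintype.card_fin] at h2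
    omega

theorem resLT_iff {n : ℕ} {I J : Finset (Fin n)} (hI : I.Nonempty) (hJ : J.Nonempty) :
    resLT (resHyperplane I) (resHyperplane J) ↔ binCode I < binCode J := by
  constructor
  · rintro ⟨I', J', -, -, h1, h2, h⟩
    rwa [resHyperplane_injective h1, resHyperplane_injective h2]
  · exact fun h => ⟨I, J, hI, hJ, rfl, rfl, h⟩

theorem isCircuit_image_iff {n : ℕ} [DecidableEq (Submodule ℝ (Fin n → ℝ))]
    {C : Finset (Finset (Fin n))} (hC : C ⊆ labelSets n) :
    IsCircuit (resonanceArr n) (C.image resHyperplane) ↔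
      ¬ LinearIndepOn ℝ indVec (C : Set (Finset (Fin n))) ∧
        ∀ D ⊂ C, LinearIndepOn ℝ indVec (D : Set (Finset (Fin n))) := by
  rw [IsCircuit, arrRank_lt_card_iff, resonanceArr_eq_image,
    and_iff_right (Finset.image_subset_image hC)]
  refine and_congr_right fun _ => ⟨fun h D hD => ?_, fun h D hD => ?_⟩
  · have := h (D.image resHyperplane)
      ((Finset.image_ssubset_image resHyperplane_injective).2 hD)
    rwa [arrRank_lt_card_iff, not_not] at this
  · obtain ⟨D, hD', rfl⟩ := Finset.subset_image_iff.1 hD.1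
    rw [arrRank_lt_card_iff, not_not]
    exact h D ((Finset.image_ssubset_image resHyperplane_injective).1 hD)

theorem forall_not_isBrokenCircuit_iff {n : ℕ} [DecidableEq (Submodule ℝ (Fin n → ℝ))]
    {s : Finset (Finset (Fin n))} (hs : s ⊆ labelSets n) :
    (∀ B ⊆ s.image resHyperplane, ¬ IsBrokenCircuit (resonanceArr n) resLT B) ↔
      IsNBC ℝ indVec binCode (labelSets n) s := by
  constructor
  · intro h J hJ hJs
    obtain ⟨R, hRs, hlt, hdep, hmin⟩ := exists_circuit_of_mem_spanBelow hJs
    have hJR : J ∉ R := fun h => lt_irrefl _ (hlt J h)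
    refine h (R.image resHyperplane) (Finset.image_subset_image hRs)
      ⟨(insert J R).image resHyperplane, resHyperplane J,
        (isCircuit_image_iff (Finset.insert_subset hJ (hRs.trans hs))).2 ⟨hdep, hmin⟩,
        Finset.mem_image_of_mem _ (Finset.mem_insert_self _ _), ?_, ?_⟩
    · intro H hH hne
      obtain ⟨I, hI, rfl⟩ := Finset.mem_image.1 hH
      rcases Finset.mem_insert.1 hI with rfl | hI
      · exact absurd rfl hne
      · exact (resLT_iff (mem_labelSets.1 (hs (hRs hI))) (mem_labelSets.1 hJ)).2 (hlt I hI)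
    · ext H
      simp only [Finset.mem_image, Finset.mem_erase, Finset.mem_insert]
      constructor
      · rintro ⟨I, hI, rfl⟩
        exact ⟨fun e => hJR (resHyperplane_injective e ▸ hI), I, Or.inr hI, rfl⟩
      · rintro ⟨hne, I, rfl | hI, rfl⟩
        · exact absurd rfl hne
        · exact ⟨I, hI, rfl⟩
  · rintro h B hB ⟨C', H, hC', hH, hlt, rfl⟩
    obtain ⟨C, hCU, rfl⟩ := Finset.subset_image_iff.1
      ((resonanceArr_eq_image n) ▸ hC'.1)
    have hCU : C ⊆ labelSets n := by exact_mod_cast hCU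
    obtain ⟨J, hJC, rfl⟩ := Finset.mem_image.1 hH
    obtain ⟨hdep, hmin⟩ := (isCircuit_image_iff hCU).1 hC'
    refine h J (hCU hJC) (Submodule.span_mono (Set.image_mono ?_)
      (mem_span_erase_of_circuit hJC hdep hmin))
    intro I hI
    obtain ⟨hIJ, hIC⟩ := Finset.mem_erase.1 hI
    have hne : resHyperplane I ≠ resHyperplane J := fun e => hIJ (resHyperplane_injective e)
    have hmem : resHyperplane I ∈ C.image resHyperplane := Finset.mem_image_of_mem _ hIC
    refine ⟨?_, (resLT_iff (mem_labelSets.1 (hCU hIC)) (mem_labelSets.1 (hCU hJC))).1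
      (hlt _ hmem hne)⟩
    have hB' : resHyperplane I ∈ s.image resHyperplane := hB (by
      simp only [Finset.mem_erase]
      exact ⟨hne, hmem⟩)
    obtain ⟨I', hI', e⟩ := Finset.mem_image.1 hB'
    rwa [← resHyperplane_injective e]

/-! ### Counting ordered set partitions by Stirling numbers -/

/-- A labelling of `Fin N` by `Fin k` is block-ordered if it is surjective and the largest members
of its fibres increase with the label. The block-ordered labellings encode the partitions of `Fin N`
into `k` blocks, listed in the order of their largest elements. -/
def IsBlockOrdered {N k : ℕ} (p : Fin N → Fin k) : Prop :=
  ∀ l, ∃ x, p x = l ∧ ∀ y, p y < l → y < x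

section BlockOrdered

variable {N k : ℕ}

theorem IsBlockOrdered.surjective {p : Fin N → Fin k} (hp : IsBlockOrdered p) :
    Function.Surjective p := fun l => (hp l).imp fun _ h => h.1

theorem isBlockOrdered_cons_of_isBlockOrdered {p : Fin N → Fin k} (hp : IsBlockOrdered p)
    (l : Fin k) : IsBlockOrdered (Fin.cons l p : Fin (N + 1) → Fin k) := by
  intro a
  obtain ⟨x, hx, hlt⟩ := hp a
  refine ⟨x.succ, by simpa using hx, fun y => ?_⟩
  cases y using Fin.cases with
  | zero => exact fun _ => Fin.succ_pos x
  | succ y => exact fun h => Fin.succ_lt_succ_iff.2 (hlt y (by simpa using h))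

theorem isBlockOrdered_cons_zero_succ {p : Fin N → Fin k} (hp : IsBlockOrdered p) :
    IsBlockOrdered (Fin.cons 0 (Fin.succ ∘ p) : Fin (N + 1) → Fin (k + 1)) := by
  intro a
  cases a using Fin.cases with
  | zero => exact ⟨0, rfl, fun y hy => absurd hy (Fin.not_lt_zero _)⟩
  | succ a =>
    obtain ⟨x, hx, hlt⟩ := hp a
    refine ⟨x.succ, by simpa using hx, fun y => ?_⟩
    cases y using Fin.cases with
    | zero => exact fun _ => Fin.succ_pos x
    | succ y => exact fun h => Fin.succ_lt_succ_iff.2 (hlt y (by simpa using h))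

/-- The least element of `Fin (N + 1)` either joins a block of the remaining elements or forms the
first block on its own. -/
theorem isBlockOrdered_cons_iff (l : Fin (k + 1)) (p : Fin N → Fin (k + 1)) :
    IsBlockOrdered (Fin.cons l p : Fin (N + 1) → Fin (k + 1)) ↔
      IsBlockOrdered p ∨ l = 0 ∧ ∃ q : Fin N → Fin k, IsBlockOrdered q ∧ p = Fin.succ ∘ q := by
  refine ⟨fun h => ?_, ?_⟩
  · have hsucc : ∀ a : Fin (k + 1), a ≠ 0 → ∃ x : Fin N, p x = a ∧ ∀ y, p y < a → y < x := by
      intro a ha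
      obtain ⟨x, hx, hlt⟩ := h a
      cases x using Fin.cases with
      | zero =>
        -- The least element is not above a preimage of `0`, so that `a` is the least label.
        obtain ⟨z, hz, -⟩ := h 0
        exact absurd (hlt z (by rw [hz]; exact Fin.pos_iff_ne_zero.2 ha)) (Fin.not_lt_zero _)
      | succ x =>
        refine ⟨x, by simpa using hx, fun y hy => ?_⟩
        exact Fin.succ_lt_succ_iff.1 (hlt y.succ (by simpa using hy))
    by_cases h0 : ∃ x, p x = 0
    · left
      intro a
      by_cases ha : a = 0
      · subst ha
        obtain ⟨x, hx⟩ := h0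
        exact ⟨x, hx, fun y hy => absurd hy (Fin.not_lt_zero _)⟩
      · exact hsucc a ha
    · right
      push Not at h0
      obtain ⟨x, hx, -⟩ := h 0
      refine ⟨?_, fun y => (p y).pred (h0 y), fun a => ?_, ?_⟩
      · cases x using Fin.cases with
        | zero => simpa using hx
        | succ x => exact absurd (by simpa using hx) (h0 x)
      · obtain ⟨x, hx, hlt⟩ := hsucc a.succ (Fin.succ_ne_zero a)
        refine ⟨x, by simp [hx], fun y hy => hlt y ?_⟩
        rw [← Fin.succ_pred (p y) (h0 y)]
        exact Fin.succ_lt_succ_iff.2 hy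
      · ext y
        simp
  · rintro (h | ⟨rfl, q, hq, rfl⟩)
    · exact isBlockOrdered_cons_of_isBlockOrdered h l
    · exact isBlockOrdered_cons_zero_succ hq

open Classical in
theorem card_isBlockOrdered (N k : ℕ) :
    (Finset.univ.filter (IsBlockOrdered (N := N) (k := k))).card = Nat.stirlingSecond N k := by
  induction N generalizing k with
  | zero =>
    cases k with
    | zero =>
      rw [Finset.filter_true_of_mem fun p _ l => l.elim0]
      simp
    | succ k =>
      rw [Finset.filter_false_of_mem fun p _ h => (h 0).choose.elim0]
      simp
  | succ N ih =>
    cases k with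
    | zero =>
      rw [Finset.filter_false_of_mem fun p _ _ => (p 0).elim0]
      simp
    | succ k =>
      rw [Nat.stirlingSecond_succ_succ, ← ih, ← ih]
      let S := Finset.univ.filter (IsBlockOrdered (N := N) (k := k + 1))
      let T := Finset.univ.filter (IsBlockOrdered (N := N) (k := k))
      let e : Fin (k + 1) × (Fin N → Fin (k + 1)) → (Fin (N + 1) → Fin (k + 1)) :=
        fun q => Fin.cons q.1 q.2
      let g : (Fin N → Fin k) → (Fin (N + 1) → Fin (k + 1)) := fun q => Fin.cons 0 (Fin.succ ∘ q)
      have he : Function.Injective e := fun a b h =>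
        Prod.ext (Fin.cons_inj.1 h).1 (Fin.cons_inj.1 h).2
      have hg : Function.Injective g := fun a b h =>
        (Fin.succ_injective k).comp_left (Fin.cons_inj.1 h).2
      have hun : Finset.univ.filter (IsBlockOrdered (N := N + 1) (k := k + 1)) =
          ((Finset.univ ×ˢ S).image e) ∪ T.image g := by
        ext p
        simp only [Finset.mem_filter, Finset.mem_univ, true_and, Finset.mem_union, Finset.mem_image,
          Finset.mem_product, S, T, e, g, Prod.exists]
        rw [← Fin.cons_self_tail p, isBlockOrdered_cons_iff]
        refine or_congr ⟨fun h => ⟨_, _, h, rfl⟩, ?_⟩ ⟨?_, ?_⟩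
        · rintro ⟨a, b, hb, h⟩
          rwa [← (Fin.cons_inj.1 h).2]
        · rintro ⟨h0, q, hq, h⟩
          exact ⟨q, hq, by rw [h0, h]⟩
        · rintro ⟨q, hq, h⟩
          exact ⟨(Fin.cons_inj.1 h).1.symm, q, hq, (Fin.cons_inj.1 h).2.symm⟩
      have hdisj : Disjoint ((Finset.univ ×ˢ S).image e) (T.image g) := by
        rw [Finset.disjoint_left]
        intro p hp hp'
        simp only [Finset.mem_image, Finset.mem_product, Finset.mem_filter, Finset.mem_univ,
          true_and, S, T, e, g, Prod.exists] at hp hp'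
        obtain ⟨a, b, hb, rfl⟩ := hp
        obtain ⟨q, -, h⟩ := hp'
        obtain ⟨x, hx⟩ := hb.surjective 0
        rw [← (Fin.cons_inj.1 h).2] at hx
        exact Fin.succ_ne_zero _ hx
      rw [hun, Finset.card_union_of_disjoint hdisj, Finset.card_image_of_injective _ he,
        Finset.card_image_of_injective _ hg, Finset.card_product]
      simp [S, T]

/-- Every map is an injective map after a block-ordered labelling. -/
theorem exists_eq_comp_isBlockOrdered {X : Type*} (h : Fin N → X) :
    ∃ (k : ℕ) (f : Fin k → X) (p : Fin N → Fin k),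
      Function.Injective f ∧ IsBlockOrdered p ∧ h = f ∘ p := by
  induction N with
  | zero => exact ⟨0, Fin.elim0, id, fun a => a.elim0, fun a => a.elim0, funext fun a => a.elim0⟩
  | succ N ih =>
    obtain ⟨k, f, p, hf, hp, hh⟩ := ih (Fin.tail h)
    by_cases hx : ∃ l, f l = h 0
    · obtain ⟨l, hl⟩ := hx
      refine ⟨k, f, Fin.cons l p, hf, isBlockOrdered_cons_of_isBlockOrdered hp l, ?_⟩
      ext y
      cases y using Fin.cases with
      | zero => exact hl.symm
      | succ y => exact congrFun hh y
    · push Not at hx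
      refine ⟨k + 1, Fin.cons (h 0) f, Fin.cons 0 (Fin.succ ∘ p),
        Fin.cons_injective_iff.2 ⟨?_, hf⟩, isBlockOrdered_cons_zero_succ hp, ?_⟩
      · rintro ⟨l, hl⟩
        exact hx l hl
      · ext y
        cases y using Fin.cases with
        | zero => rfl
        | succ y => exact congrFun hh y

/-- Two block-ordered labellings with the same fibres agree, since the bijection between the labels
is monotone. -/
theorem eq_of_comp_eq_comp {X : Type*} {f f' : Fin k → X} {p p' : Fin N → Fin k}
    (hf : Function.Injective f) (hf' : Function.Injective f') (hp : IsBlockOrdered p)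
    (hp' : IsBlockOrdered p') (h : f ∘ p = f' ∘ p') : f = f' ∧ p = p' := by
  have hiff : ∀ x y, p x = p y ↔ p' x = p' y := fun x y => by
    rw [← hf.eq_iff, ← hf'.eq_iff]
    exact iff_of_eq (congrArg₂ _ (congrFun h x) (congrFun h y))
  choose r hr using hp.surjective
  have hσp : ∀ x, p' (r (p x)) = p' x := fun x => (hiff _ _).1 (hr _)
  have hmono : StrictMono fun l => p' (r l) := by
    intro l l' hll
    by_contra hge
    have hne : p' (r l) ≠ p' (r l') := by
      rw [Ne, ← hiff, hr, hr]
      exact hll.ne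
    have hlt : p' (r l') < p' (r l) := lt_of_le_of_ne (not_lt.1 hge) hne.symm
    obtain ⟨x, hx, h1⟩ := hp l'
    obtain ⟨x', hx', h2⟩ := hp' (p' (r l))
    have hx'l : p x' = l := by rw [← hr l, hiff, hx']
    have hxl' : p' x = p' (r l') := by rw [← hiff, hr, hx]
    exact lt_asymm (h1 x' (hx'l ▸ hll)) (h2 x (hxl' ▸ hlt))
  have hid : ∀ l, p' (r l) = l := by
    intro l
    have := hmono.eq_id
    exact congrFun this l
  have hpp : p = p' := funext fun x => by rw [← hid (p x), hσp]
  refine ⟨funext fun l => ?_, hpp⟩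
  have := congrFun h (r l)
  simpa only [Function.comp_apply, ← hpp, hr] using this

end BlockOrdered

/-! ### Independence of functionality from the partition -/

/-- A tuple of pairwise different non-empty sets of labels whose hyperplanes contain no broken
circuit. -/
def IsNBCTuple {i m : ℕ} (a : Fin i → Finset (Fin m)) : Prop :=
  Function.Injective a ∧ (∀ j, (a j).Nonempty) ∧
    IsNBC ℝ indVec binCode (labelSets m) (Finset.univ.image a)

/-- The incidence relation between `Fin m` and `Fin i` given by `f`, read in the other direction. -/
def transposeSets {i m : ℕ} (f : Fin m → Finset (Fin i)) (j : Fin i) : Finset (Fin m) :=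
  Finset.univ.filter fun l => j ∈ f l

theorem mem_transposeSets {i m : ℕ} {f : Fin m → Finset (Fin i)} {j : Fin i} {l : Fin m} :
    l ∈ transposeSets f j ↔ j ∈ f l := by
  simp [transposeSets]

theorem transposeSets_transposeSets {i m : ℕ} (f : Fin m → Finset (Fin i)) :
    transposeSets (transposeSets f) = f := by
  ext l j
  rw [mem_transposeSets, mem_transposeSets]

section Pullback

variable {m n : ℕ}

/-- The union of the blocks with label in `J`. The labelling `p` has one more element and one more
label than needed; these last ones correspond to each other if `p` is block-ordered. -/
def unionBlocks (p : Fin (n + 1) → Fin (m + 1)) (J : Finset (Fin m)) : Finset (Fin n) :=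
  Finset.univ.filter fun x => ∃ l ∈ J, p x.castSucc = l.castSucc

/-- The linear map taking the coordinate of `x` from its block, and `0` on the last block. On
indicator vectors this is `unionBlocks`. -/
def blockMap (p : Fin (n + 1) → Fin (m + 1)) : (Fin m → ℝ) →ₗ[ℝ] (Fin n → ℝ) where
  toFun v x := if h : p x.castSucc = Fin.last m then 0 else v ((p x.castSucc).castPred h)
  map_add' v w := by
    ext x
    by_cases h : p x.castSucc = Fin.last m <;> simp [h]
  map_smul' r v := by
    ext x
    by_cases h : p x.castSucc = Fin.last m <;> simp [h]

variable {p : Fin (n + 1) → Fin (m + 1)}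

theorem mem_unionBlocks {J : Finset (Fin m)} {x : Fin n} :
    x ∈ unionBlocks p J ↔ ∃ l ∈ J, p x.castSucc = l.castSucc := by
  simp [unionBlocks]

theorem mem_unionBlocks_of_eq {J : Finset (Fin m)} {x : Fin n} {l : Fin m}
    (h : p x.castSucc = l.castSucc) : x ∈ unionBlocks p J ↔ l ∈ J := by
  rw [mem_unionBlocks]
  refine ⟨?_, fun hl => ⟨l, hl, h⟩⟩
  rintro ⟨l', hl', h'⟩
  rwa [Fin.castSucc_injective m (h.symm.trans h')]

theorem blockMap_apply_of_eq {x : Fin n} {l : Fin m} (h : p x.castSucc = l.castSucc)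
    (v : Fin m → ℝ) : blockMap p v x = v l := by
  simp [blockMap, h]

theorem blockMap_indVec (J : Finset (Fin m)) :
    blockMap p (indVec J) = indVec (unionBlocks p J) := by
  ext x
  by_cases h : p x.castSucc = Fin.last m
  · have : x ∉ unionBlocks p J := by
      rw [mem_unionBlocks, h]
      rintro ⟨l, -, hl⟩
      exact (Fin.castSucc_lt_last l).ne hl.symm
    simp [blockMap, h, indVec, this]
  · have h' : p x.castSucc = ((p x.castSucc).castPred h).castSucc := by simp
    rw [blockMap_apply_of_eq h']
    simp only [indVec, mem_unionBlocks_of_eq h']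

theorem IsBlockOrdered.apply_last (hp : IsBlockOrdered p) : p (Fin.last n) = Fin.last m := by
  obtain ⟨x, hx, hlt⟩ := hp (Fin.last m)
  by_contra h
  exact absurd (hlt _ (Fin.lt_last_iff_ne_last.2 h)) (not_lt.2 (Fin.le_last x))

theorem IsBlockOrdered.exists_castSucc (hp : IsBlockOrdered p) (l : Fin m) :
    ∃ x : Fin n, p x.castSucc = l.castSucc ∧
      ∀ y : Fin n, p y.castSucc < l.castSucc → y < x := by
  obtain ⟨x, hx, hlt⟩ := hp l.castSucc
  have hne : x ≠ Fin.last n := by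
    rintro rfl
    exact (Fin.castSucc_lt_last l).ne (hx.symm.trans hp.apply_last)
  obtain ⟨x, rfl⟩ := Fin.exists_castSucc_eq.2 hne
  exact ⟨x, hx, fun y hy => Fin.castSucc_lt_castSucc_iff.1 (hlt _ hy)⟩

theorem unionBlocks_injective (hp : IsBlockOrdered p) : Function.Injective (unionBlocks p) := by
  intro J J' h
  ext l
  obtain ⟨x, hx, -⟩ := hp.exists_castSucc l
  rw [← mem_unionBlocks_of_eq hx, h, mem_unionBlocks_of_eq hx]

theorem blockMap_injective (hp : IsBlockOrdered p) : Function.Injective (blockMap p) := by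
  intro v w h
  ext l
  obtain ⟨x, hx, -⟩ := hp.exists_castSucc l
  rw [← blockMap_apply_of_eq hx v, h, blockMap_apply_of_eq hx]

/-- Since the largest elements of the blocks increase, unions of blocks compare like the sets of
their labels. -/
theorem binCode_unionBlocks_lt_iff (hp : IsBlockOrdered p) {J J' : Finset (Fin m)} :
    binCode (unionBlocks p J) < binCode (unionBlocks p J') ↔ binCode J < binCode J' := by
  have key : ∀ {J J' : Finset (Fin m)}, binCode J < binCode J' →
      binCode (unionBlocks p J) < binCode (unionBlocks p J') := by
    intro J J' h
    rw [binCode_lt_iff] at h ⊢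
    obtain ⟨a, ha', ha, hlt⟩ := h
    obtain ⟨x, hx, hxlt⟩ := hp.exists_castSucc a
    refine ⟨x, (mem_unionBlocks_of_eq hx).2 ha', fun h => ha ((mem_unionBlocks_of_eq hx).1 h), ?_⟩
    intro y hy hy'
    obtain ⟨b, hb, hyb⟩ := mem_unionBlocks.1 hy
    rw [mem_unionBlocks_of_eq hyb] at hy'
    exact hxlt y (by rw [hyb]; exact Fin.castSucc_lt_castSucc_iff.2 (hlt b hb hy'))
  refine ⟨fun h => ?_, key⟩
  rcases lt_trichotomy (binCode J) (binCode J') with h' | h' | h'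
  · exact h'
  · rw [binCode_injective h'] at h
    exact absurd h (lt_irrefl _)
  · exact absurd (key h') h.asymm

theorem unionBlocks_nonempty (hp : IsBlockOrdered p) {J : Finset (Fin m)} :
    (unionBlocks p J).Nonempty ↔ J.Nonempty := by
  constructor
  · rintro ⟨x, hx⟩
    obtain ⟨l, hl, -⟩ := mem_unionBlocks.1 hx
    exact ⟨l, hl⟩
  · rintro ⟨l, hl⟩
    obtain ⟨x, hx, -⟩ := hp.exists_castSucc l
    exact ⟨x, (mem_unionBlocks_of_eq hx).2 hl⟩

theorem spanBelow_unionBlocks (hp : IsBlockOrdered p) (s : Finset (Finset (Fin m)))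
    (J : Finset (Fin m)) :
    spanBelow ℝ indVec binCode (s.image (unionBlocks p)) (unionBlocks p J) =
      (spanBelow ℝ indVec binCode s J).map (blockMap p) := by
  rw [spanBelow, spanBelow, Submodule.map_span, Set.image_image]
  simp only [blockMap_indVec]
  rw [← Set.image_image indVec (unionBlocks p)]
  congr 2
  ext I
  simp only [Finset.mem_image, Set.mem_ofPred_eq, Set.mem_image]
  constructor
  · rintro ⟨⟨I, hI, rfl⟩, h⟩
    exact ⟨I, ⟨hI, (binCode_unionBlocks_lt_iff hp).1 h⟩, rfl⟩
  · rintro ⟨I, ⟨hI, h⟩, rfl⟩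
    exact ⟨⟨I, hI, rfl⟩, (binCode_unionBlocks_lt_iff hp).2 h⟩

/-- Every `0`-`1` vector in the span of unions of blocks is itself the vector of a union of
blocks. -/
theorem isNBC_image_unionBlocks_iff (hp : IsBlockOrdered p) (s : Finset (Finset (Fin m))) :
    IsNBC ℝ indVec binCode (labelSets n) (s.image (unionBlocks p)) ↔
      IsNBC ℝ indVec binCode (labelSets m) s := by
  constructor
  · intro h J hJ hmem
    refine h (unionBlocks p J)
      (mem_labelSets.2 ((unionBlocks_nonempty hp).2 (mem_labelSets.1 hJ))) ?_
    rw [spanBelow_unionBlocks hp, ← blockMap_indVec]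
    exact Submodule.mem_map_of_mem hmem
  · intro h J hJ hmem
    have hrange : indVec J ∈ LinearMap.range (blockMap p) := by
      refine Submodule.span_le.2 ?_ hmem
      rintro _ ⟨I, ⟨hI, -⟩, rfl⟩
      obtain ⟨I, -, rfl⟩ := Finset.mem_image.1 hI
      exact ⟨indVec I, blockMap_indVec I⟩
    obtain ⟨w, hw⟩ := hrange
    -- Each coordinate of `w` is a coordinate of the `0`-`1` vector of `J`.
    have hw' : w = indVec (Finset.univ.filter fun l => w l = 1) := by
      ext l
      obtain ⟨x, hx, -⟩ := hp.exists_castSucc l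
      have := congrFun hw x
      rw [blockMap_apply_of_eq hx] at this
      by_cases h1 : w l = 1
      · simp [indVec, h1]
      · have h0 : w l = 0 := by
          rw [this] at h1 ⊢
          simp only [indVec] at h1 ⊢
          split_ifs at h1 ⊢ with hxJ
          · exact absurd rfl h1
          · rfl
        simp [indVec, h0]
    rw [hw', blockMap_indVec] at hw
    obtain rfl := indVec_injective hw
    rw [spanBelow_unionBlocks hp, ← blockMap_indVec] at hmem
    obtain ⟨w', hw1, hw2⟩ := hmem
    rw [blockMap_injective hp hw2] at hw1
    exact h _ (mem_labelSets.2 ((unionBlocks_nonempty hp).1 (mem_labelSets.1 hJ))) hw1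

theorem isNBCTuple_unionBlocks_iff (hp : IsBlockOrdered p) {i : ℕ} (a : Fin i → Finset (Fin m)) :
    IsNBCTuple (fun j => unionBlocks p (a j)) ↔ IsNBCTuple a := by
  rw [IsNBCTuple, IsNBCTuple, ← isNBC_image_unionBlocks_iff hp (Finset.univ.image a),
    Finset.image_image]
  refine and_congr ((unionBlocks_injective hp).of_comp_iff a) (and_congr ?_ Iff.rfl)
  simp only [unionBlocks_nonempty hp]

end Pullback

theorem isNBCTuple_iff {i m : ℕ} [DecidableEq (Submodule ℝ (Fin m → ℝ))]
    (a : Fin i → Finset (Fin m)) :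
    (Function.Injective a ∧ (∀ j, (a j).Nonempty) ∧
      ∀ B ⊆ Finset.univ.image (fun j => resHyperplane (a j)),
        ¬ IsBrokenCircuit (resonanceArr m) resLT B) ↔ IsNBCTuple a := by
  refine and_congr_right fun _ => and_congr_right fun h => ?_
  rw [← forall_not_isBrokenCircuit_iff, Finset.image_image]
  · rfl
  · intro I hI
    obtain ⟨j, -, rfl⟩ := Finset.mem_image.1 hI
    exact mem_labelSets.2 (h j)

/-- The blocks listed in the order of their binary numbers are also listed in the order of their
largest elements. -/
theorem exists_isBlockOrdered_of_isOrderedBlocks {n k : ℕ}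
    {p : Finpartition (Finset.univ : Finset (Fin (n + 1)))} {P : Fin k → Finset (Fin (n + 1))}
    (h : IsOrderedBlocks p P) :
    ∃ q : Fin (n + 1) → Fin k, IsBlockOrdered q ∧ ∀ x l, x ∈ P l ↔ q x = l := by
  obtain ⟨himg, hmono⟩ := h
  have hmem : ∀ l, P l ∈ p.parts := fun l => by
    rw [← himg]
    exact Finset.mem_image_of_mem _ (Finset.mem_univ l)
  have hinj : Function.Injective P := fun a b hab => hmono.injective (congrArg binCode hab)
  have hex : ∀ x, ∃ l, x ∈ P l := by
    intro x
    obtain ⟨B, hB, hx⟩ := p.exists_mem (Finset.mem_univ x)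
    rw [← himg] at hB
    obtain ⟨l, -, rfl⟩ := Finset.mem_image.1 hB
    exact ⟨l, hx⟩
  have huniq : ∀ {x l l'}, x ∈ P l → x ∈ P l' → l = l' := fun h h' =>
    hinj (p.eq_of_mem_parts (hmem _) (hmem _) h h')
  choose q hq using hex
  have hiff : ∀ x l, x ∈ P l ↔ q x = l := fun x l =>
    ⟨fun h => huniq (hq x) h, fun h => h ▸ hq x⟩
  refine ⟨q, fun l => ?_, hiff⟩
  have hne : (P l).Nonempty := p.nonempty_of_mem_parts (hmem l)
  refine ⟨(P l).max' hne, (hiff _ _).1 (Finset.max'_mem _ _), fun y hy => ?_⟩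
  obtain ⟨a, ha, -, hlt⟩ := binCode_lt_iff.1 (hmono hy)
  refine (hlt y (hq y) fun h => ?_).trans_le (Finset.le_max' _ a ha)
  exact hy.ne ((hiff _ _).1 h)

theorem isOrderedBlocks_bot (n : ℕ) :
    IsOrderedBlocks (⊥ : Finpartition (Finset.univ : Finset (Fin (n + 1)))) (fun l => {l}) := by
  constructor
  · ext B
    simp
  · intro a b hab
    simpa [binCode] using Nat.pow_lt_pow_right one_lt_two hab

/-- Whether a prototype is functional does not depend on the partition, so that it can be read off
the partition into singletons. -/
theorem isFunctional_succ_iff {i m : ℕ} (him : i ≤ m) (f : Fin m → Finset (Fin i)) :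
    IsFunctional i (m + 1) f ↔ IsPrototype i (m + 1) f ∧ IsNBCTuple (transposeSets f) := by
  classical
  refine and_congr_right fun _ => ⟨fun h => ?_, fun h n hn p P hP => ?_⟩
  · rcases Nat.eq_zero_or_pos m with rfl | hm
    · obtain rfl : i = 0 := by omega
      refine ⟨fun a => a.elim0, fun a => a.elim0, fun J hJ => ?_⟩
      exact (mem_labelSets.1 hJ).choose.elim0
    · have key := h m hm ⊥ _ (isOrderedBlocks_bot m)
      rw [← isNBCTuple_iff]
      have heq : protoTuple (k := m + 1) (n := m) f (fun l => {l}) = transposeSets f := by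
        ext j x
        simp only [protoTuple, Finset.mem_filter, Finset.mem_univ, true_and, Finset.mem_singleton,
          mem_transposeSets]
        constructor
        · rintro ⟨l, hl, hx⟩
          obtain rfl : x = l := Fin.castSucc_injective m hx
          exact hl
        · exact fun h => ⟨x, h, rfl⟩
      rw [heq] at key
      exact ⟨key.1, key.2.1, fun B hB => key.2.2 B (by convert hB)⟩
  · obtain ⟨q, hq, hPq⟩ := exists_isBlockOrdered_of_isOrderedBlocks hP
    have heq : protoTuple (k := m + 1) f P = fun j => unionBlocks q (transposeSets f j) := by
      ext j x
      simp only [protoTuple, Finset.mem_filter, Finset.mem_univ, true_and, mem_unionBlocks,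
        mem_transposeSets, hPq]
      rfl
    rw [← isNBCTuple_unionBlocks_iff hq, ← heq, ← isNBCTuple_iff] at h
    exact ⟨h.1, h.2.1, fun B hB => h.2.2 B (by convert hB)⟩

/-! ### Existence of functional prototypes -/

/-- If the last `i` labels form a staircase, then the tuple contains no broken circuit, whatever the
other labels are: a `0`-`1` vector in the span of the tuple which exceeds all members it involves
agrees with the largest of these on the staircase, hence equals it. -/
theorem isNBCTuple_of_staircase {d i : ℕ} {a : Fin i → Finset (Fin (d + i))}
    (ha : ∀ l j, Fin.natAdd d l ∈ a j ↔ l ≤ j) : IsNBCTuple a := by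
  refine ⟨fun j j' h => ?_, fun j => ⟨_, (ha j j).2 le_rfl⟩, fun J hJ hmem => ?_⟩
  · exact le_antisymm ((ha _ _).1 (h ▸ (ha j j).2 le_rfl)) ((ha _ _).1 (h ▸ (ha j' j').2 le_rfl))
  let T : Finset (Fin i) := Finset.univ.filter fun j => binCode (a j) < binCode J
  have hset : {I | I ∈ Finset.univ.image a ∧ binCode I < binCode J} = a '' (T : Set (Fin i)) := by
    ext I
    simp only [Finset.mem_image, Finset.mem_univ, true_and, Set.mem_ofPred_eq, T, Set.mem_image,
      Finset.coe_filter]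
    constructor
    · rintro ⟨⟨j, rfl⟩, h⟩
      exact ⟨j, h, rfl⟩
    · rintro ⟨j, h, rfl⟩
      exact ⟨⟨j, rfl⟩, h⟩
  rw [spanBelow, hset, Set.image_image, Submodule.mem_span_image_finset_iff_exists_fun'] at hmem
  obtain ⟨r, hr⟩ := hmem
  have hval : ∀ l, indVec J (Fin.natAdd d l) = ∑ j ∈ T with l ≤ j, r j := by
    intro l
    rw [← hr, Finset.sum_apply, Finset.sum_filter (l ≤ ·)]
    refine Finset.sum_congr rfl fun j _ => ?_
    simp [indVec, ha]
  have hT : T.Nonempty := by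
    by_contra hT
    rw [Finset.not_nonempty_iff_eq_empty] at hT
    rw [hT, Finset.sum_empty, eq_comm, indVec_eq_zero_iff] at hr
    exact (mem_labelSets.1 hJ).ne_empty hr
  set t := T.max' hT with ht
  have htT : t ∈ T := Finset.max'_mem T hT
  have hle : ∀ j ∈ T, j ≤ t := fun j hj => Finset.le_max' T j hj
  have htJ : binCode (a t) < binCode J := (Finset.mem_filter.1 htT).2
  obtain ⟨x, hxJ, hxt, hlt⟩ := binCode_lt_iff.1 htJ
  induction x using Fin.addCases with
  | right l =>
    -- No member of the tuple which is smaller than `J` contains a staircase label above the `t`-th.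
    have hlt' : t < l := not_le.1 fun h => hxt ((ha _ _).2 h)
    have h0 := hval l
    rw [Finset.filter_false_of_mem fun j hj h => absurd (h.trans (hle j hj)) (not_le.2 hlt'),
      Finset.sum_empty] at h0
    simp [indVec, hxJ] at h0
  | left y =>
    -- Here `J` contains the staircase part of `a t`, which lies above `x`; comparing consecutive
    -- partial sums of the coefficients shows that only `a t` contributes.
    have hone : ∀ l ≤ t, ∑ j ∈ T with l ≤ j, r j = 1 := by
      intro l hl
      have hlJ : Fin.natAdd d l ∈ J := by
        by_contra h
        have := hlt _ ((ha l t).2 hl) h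
        rw [Fin.lt_def] at this
        simp only [Fin.val_natAdd, Fin.val_castAdd] at this
        omega
      rw [← hval, indVec, if_pos hlJ]
    have hrt : r t = 1 := by
      rw [← hone t le_rfl]
      have : T.filter (t ≤ ·) = {t} := by
        ext j
        simp only [Finset.mem_filter, Finset.mem_singleton]
        exact ⟨fun h => le_antisymm (hle j h.1) h.2, fun h => ⟨h ▸ htT, h.ge⟩⟩
      rw [this, Finset.sum_singleton]
    have hr0 : ∀ j ∈ T, j ≠ t → r j = 0 := by
      intro j hj hjt
      have hjlt : j < t := lt_of_le_of_ne (hle j hj) hjt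
      let j' : Fin i := ⟨j + 1, by omega⟩
      have h1 := hone j hjlt.le
      have h2 := hone j' hjlt
      have : T.filter (j ≤ ·) = insert j (T.filter (j' ≤ ·)) := by
        ext b
        simp only [Finset.mem_filter, Finset.mem_insert, j', Fin.le_def, Fin.ext_iff]
        constructor
        · rintro ⟨hb, h⟩
          rcases h.eq_or_lt with h | h
          · exact Or.inl h.symm
          · exact Or.inr ⟨hb, h⟩
        · rintro (h | ⟨hb, h⟩)
          · obtain rfl : b = j := Fin.ext h
            exact ⟨hj, le_rfl⟩
          · exact ⟨hb, by omega⟩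
      rw [this, Finset.sum_insert (by simp [j', Fin.le_def]), h2] at h1
      linarith
    rw [Finset.sum_eq_single_of_mem t htT fun j hj hjt => by rw [hr0 j hj hjt, zero_smul], hrt,
      one_smul] at hr
    rw [indVec_injective hr] at htJ
    exact lt_irrefl _ htJ

theorem card_nonempty_finset (i : ℕ) :
    Fintype.card {s : Finset (Fin i) // s.Nonempty} = 2 ^ i - 1 := by
  simp_rw [Finset.nonempty_iff_ne_empty]
  rw [Fintype.card_subtype_compl]
  simp

theorem exists_isFunctional {i m : ℕ} (him : i ≤ m) (hm : m + 1 ≤ 2 ^ i) :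
    ∃ f, IsFunctional i (m + 1) f := by
  classical
  obtain ⟨d, rfl⟩ := Nat.exists_eq_add_of_le' him
  let g : Fin i → {s : Finset (Fin i) // s.Nonempty} := fun l => ⟨Finset.Ici l, l, by simp⟩
  have hg : Function.Injective g := by
    intro l l' h
    have h : Finset.Ici l = Finset.Ici l' := congrArg Subtype.val h
    exact le_antisymm (Finset.mem_Ici.1 (h ▸ Finset.mem_Ici.2 le_rfl))
      (Finset.mem_Ici.1 (h.symm ▸ Finset.mem_Ici.2 le_rfl))
  have hcard : Fintype.card (Fin d) ≤
      Fintype.card {s : {s : Finset (Fin i) // s.Nonempty} // s ∉ Set.range g} := by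
    rw [Fintype.card_subtype_compl, card_nonempty_finset, Fintype.card_fin,
      ← Set.toFinset_card, Set.toFinset_range, Finset.card_image_of_injective _ hg,
      Finset.card_univ, Fintype.card_fin]
    omega
  obtain ⟨r⟩ := Function.Embedding.nonempty_of_card_le hcard
  let f : Fin (d + i) → {s : Finset (Fin i) // s.Nonempty} := Fin.append (fun x => (r x).1) g
  have hf : Function.Injective f := by
    rw [Fin.append_injective_iff]
    exact ⟨Subtype.val_injective.comp r.injective, hg, fun x l h => (r x).2 ⟨l, h.symm⟩⟩
  refine ⟨fun l => (f l).1, (isFunctional_succ_iff him _).2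
    ⟨⟨Subtype.val_injective.comp hf, fun l => (f l).2⟩, isNBCTuple_of_staircase fun l j => ?_⟩⟩
  rw [mem_transposeSets]
  simp [f, g]

/-! ### Counting prototypes and tuples -/

/-- Every set with `i` elements is the range of exactly `i!` injective tuples. -/
theorem card_injective_tuples {α : Type*} [Fintype α] [DecidableEq α] (i : ℕ) (Q : Finset α → Prop)
    [DecidablePred Q]
    [DecidablePred fun a : Fin i → α => Function.Injective a ∧ Q (Finset.univ.image a)] :
    (Finset.univ.filter fun a : Fin i → α =>
      Function.Injective a ∧ Q (Finset.univ.image a)).card =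
      i.factorial * ((Finset.univ.powersetCard i).filter Q).card := by
  rw [Finset.card_eq_sum_card_fiberwise (f := fun a => Finset.univ.image a)
    (t := (Finset.univ.powersetCard i).filter Q)]
  · rw [Finset.sum_congr rfl (g := fun _ => i.factorial), Finset.sum_const, smul_eq_mul, mul_comm]
    intro s hs
    rw [Finset.mem_filter, Finset.mem_powersetCard] at hs
    obtain ⟨⟨-, hcard⟩, hQ⟩ := hs
    have hF : Fintype.card (Fin i ↪ s) = i.factorial := by
      rw [Fintype.card_embedding_eq, Fintype.card_fin, Fintype.card_coe, hcard,
        Nat.descFactorial_self]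
    rw [← hF, ← Finset.card_univ]
    symm
    refine Finset.card_bij (fun e _ => fun j => (e j).1) ?_ ?_ ?_
    · intro e _
      have hinj : Function.Injective fun j => (e j).1 := Subtype.val_injective.comp e.injective
      have himg : Finset.univ.image (fun j => (e j).1) = s := by
        refine Finset.eq_of_subset_of_card_le ?_ ?_
        · intro x hx
          obtain ⟨j, -, rfl⟩ := Finset.mem_image.1 hx
          exact (e j).2
        · rw [Finset.card_image_of_injective _ hinj, hcard, Finset.card_univ, Fintype.card_fin]
      simp only [Finset.mem_filter, Finset.mem_univ, true_and]
      exact ⟨⟨hinj, himg.symm ▸ hQ⟩, himg⟩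
    · intro e _ e' _ h
      ext j
      exact congrFun h j
    · intro a ha
      simp only [Finset.mem_filter, Finset.mem_univ, true_and] at ha
      refine ⟨⟨fun j => ⟨a j, ha.2 ▸ Finset.mem_image_of_mem _ (Finset.mem_univ j)⟩, ?_⟩,
        Finset.mem_univ _, rfl⟩
      intro j j' h
      exact ha.1.1 (congrArg Subtype.val h)
  · intro a ha
    simp only [Finset.coe_filter, Finset.mem_univ, true_and, Set.mem_ofPred_eq,
      Finset.mem_powersetCard, Finset.subset_univ] at ha ⊢
    exact ⟨by rw [Finset.card_image_of_injective _ ha.1, Finset.card_univ, Fintype.card_fin], ha.2⟩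

theorem isNBCTuple_iff_image {i m : ℕ} (a : Fin i → Finset (Fin m)) :
    IsNBCTuple a ↔ Function.Injective a ∧ (Finset.univ.image a ⊆ labelSets m ∧
      IsNBC ℝ indVec binCode (labelSets m) (Finset.univ.image a)) := by
  rw [IsNBCTuple, Finset.image_subset_iff]
  simp [mem_labelSets]

open Classical in
theorem card_isNBCTuple (i n : ℕ) :
    (Finset.univ.filter (IsNBCTuple (i := i) (m := n))).card =
      i.factorial * bettiNumber (resonanceArr n) i := by
  simp_rw [isNBCTuple_iff_image]
  rw [card_injective_tuples i fun s => s ⊆ labelSets n ∧ IsNBC ℝ indVec binCode (labelSets n) s,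
    bettiNumber_resonanceArr]
  congr 2
  ext s
  simp only [Finset.mem_filter, Finset.mem_powersetCard, Finset.subset_univ, true_and]
  tauto

theorem IsNBCTuple.le {i m : ℕ} {a : Fin i → Finset (Fin m)} (ha : IsNBCTuple a) : i ≤ m := by
  obtain ⟨hinj, hsub, hnbc⟩ := (isNBCTuple_iff_image a).1 ha
  have h := (linearIndepOn_iff_finrank_span_eq_card _).1
    (hnbc.linearIndepOn hsub binCode_injective.injOn)
  rw [Finset.card_image_of_injective _ hinj, Finset.card_univ, Fintype.card_fin] at h
  rw [← h]
  simpa using Submodule.finrank_le (Submodule.span ℝ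
    (indVec '' ((Finset.univ.image a : Finset (Finset (Fin m))) : Set (Finset (Fin m)))))

open Classical in
theorem factorial_dvd_card_isFunctional {i m : ℕ} (him : i ≤ m) :
    i.factorial ∣ (Finset.univ.filter (IsFunctional i (m + 1))).card := by
  -- In terms of the tuple of sets, being a prototype means that the sets separate and cover the
  -- labels, which depends only on the range of the tuple.
  let Q : Finset (Finset (Fin m)) → Prop := fun s =>
    (s ⊆ labelSets m ∧ IsNBC ℝ indVec binCode (labelSets m) s) ∧
      (∀ l l', (∀ I ∈ s, l ∈ I ↔ l' ∈ I) → l = l') ∧ ∀ l, ∃ I ∈ s, l ∈ I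
  have h : (Finset.univ.filter (IsFunctional i (m + 1))).card =
      (Finset.univ.filter fun a : Fin i → Finset (Fin m) =>
        Function.Injective a ∧ Q (Finset.univ.image a)).card := by
    refine Finset.card_bij' (fun f _ => transposeSets f) (fun a _ => transposeSets a) ?_ ?_
      (fun f _ => transposeSets_transposeSets f) (fun a _ => transposeSets_transposeSets a)
    · intro f hf
      obtain ⟨⟨hinj, hne⟩, hnbc⟩ := (isFunctional_succ_iff him f).1 (Finset.mem_filter.1 hf).2
      rw [isNBCTuple_iff_image] at hnbc
      refine Finset.mem_filter.2 ⟨Finset.mem_univ _, hnbc.1, hnbc.2, fun l l' h => ?_, fun l => ?_⟩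
      · refine hinj (Finset.ext fun j => ?_)
        simpa only [mem_transposeSets] using
          h _ (Finset.mem_image_of_mem (transposeSets f) (Finset.mem_univ j))
      · obtain ⟨j, hj⟩ := hne l
        exact ⟨_, Finset.mem_image_of_mem _ (Finset.mem_univ j), mem_transposeSets.2 hj⟩
    · intro a ha
      obtain ⟨-, hinj, hnbc, hsep, hcov⟩ := Finset.mem_filter.1 ha
      refine Finset.mem_filter.2 ⟨Finset.mem_univ _, (isFunctional_succ_iff him _).2
        ⟨⟨fun l l' h => hsep l l' ?_, fun l => ?_⟩, ?_⟩⟩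
      · intro I hI
        obtain ⟨j, -, rfl⟩ := Finset.mem_image.1 hI
        rw [← mem_transposeSets (f := a), h, mem_transposeSets]
      · obtain ⟨I, hI, hl⟩ := hcov l
        obtain ⟨j, -, rfl⟩ := Finset.mem_image.1 hI
        exact ⟨j, mem_transposeSets.2 hl⟩
      · rw [transposeSets_transposeSets, isNBCTuple_iff_image]
        exact ⟨hinj, hnbc⟩
  rw [h, card_injective_tuples i Q]
  exact dvd_mul_right _ _

open Classical in
theorem card_isFunctional_le (i m : ℕ) :
    (Finset.univ.filter (IsFunctional i (m + 1))).card ≤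
      (2 ^ i - 1).choose m * m.factorial := by
  have h : (2 ^ i - 1).choose m * m.factorial =
      Fintype.card (Fin m ↪ {s : Finset (Fin i) // s.Nonempty}) := by
    rw [Fintype.card_embedding_eq, card_nonempty_finset, Fintype.card_fin,
      Nat.descFactorial_eq_factorial_mul_choose, mul_comm]
  rw [h, ← Fintype.card_subtype]
  refine Fintype.card_le_of_injective (fun f : {f // IsFunctional i (m + 1) f} =>
    (⟨fun l => ⟨f.1 l, f.2.1.2 l⟩, fun l l' hl => f.2.1.1 (congrArg Subtype.val hl)⟩ :
      Fin m ↪ {s : Finset (Fin i) // s.Nonempty})) ?_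
  intro f f' hff
  refine Subtype.ext (funext fun l => ?_)
  exact congrArg Subtype.val (DFunLike.congr_fun hff l)

/-- The membership patterns of the elements of `[n + 1]` with respect to a tuple of subsets of
`[n]`. The fibres of this map are the blocks of the partition associated with the tuple. -/
def membershipPattern {i n : ℕ} (a : Fin i → Finset (Fin n)) : Fin (n + 1) → Finset (Fin i) :=
  Fin.snoc (α := fun _ => Finset (Fin i)) (transposeSets a) ∅

theorem membershipPattern_unionBlocks {i m n : ℕ} (f : Fin m → Finset (Fin i))
    {p : Fin (n + 1) → Fin (m + 1)} (hp : IsBlockOrdered p) :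
    membershipPattern (fun j => unionBlocks p (transposeSets f j)) =
      Fin.snoc (α := fun _ => Finset (Fin i)) f ∅ ∘ p := by
  ext x j
  cases x using Fin.lastCases with
  | last => simp [membershipPattern, hp.apply_last]
  | cast x =>
    simp only [membershipPattern, Fin.snoc_castSucc, mem_transposeSets, Function.comp_apply]
    by_cases h : p x.castSucc = Fin.last m
    · rw [h, Fin.snoc_last, mem_unionBlocks, h]
      simp only [Finset.notMem_empty, iff_false]
      rintro ⟨l, -, hl⟩
      exact (Fin.castSucc_lt_last l).ne hl.symm
    · obtain ⟨l, hl⟩ := Fin.exists_castSucc_eq.2 h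
      rw [mem_unionBlocks_of_eq hl.symm, ← hl, Fin.snoc_castSucc, mem_transposeSets]

theorem membershipPattern_injective {i n : ℕ} :
    Function.Injective (membershipPattern (i := i) (n := n)) := by
  intro a b h
  have h' : transposeSets a = transposeSets b := by
    ext1 x
    simpa [membershipPattern] using congrFun h x.castSucc
  rw [← transposeSets_transposeSets a, h', transposeSets_transposeSets]

theorem snoc_empty_injective {i m : ℕ} {f : Fin m → Finset (Fin i)}
    (hf : IsPrototype i (m + 1) f) :
    Function.Injective (Fin.snoc (α := fun _ => Finset (Fin i)) f ∅) := by
  rw [Fin.snoc_injective_iff]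
  refine ⟨hf.1, ?_⟩
  rintro ⟨l, hl⟩
  exact (hf.2 l).ne_empty hl

/-- Every tuple of sets arises from a prototype and a partition. -/
theorem exists_eq_unionBlocks {i n : ℕ} (a : Fin i → Finset (Fin n)) :
    ∃ (m : ℕ) (f : Fin m → Finset (Fin i)) (p : Fin (n + 1) → Fin (m + 1)),
      IsPrototype i (m + 1) f ∧ IsBlockOrdered p ∧
        a = fun j => unionBlocks p (transposeSets f j) := by
  obtain ⟨k, g, p, hg, hp, hh⟩ := exists_eq_comp_isBlockOrdered (membershipPattern a)
  obtain _ | m := k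
  · exact (p 0).elim0
  have hlast : g (Fin.last m) = ∅ := by
    rw [← hp.apply_last]
    have := congrFun hh (Fin.last n)
    simpa [membershipPattern] using this.symm
  have hg' : g = Fin.snoc (α := fun _ => Finset (Fin i)) (Fin.init g) ∅ := by
    rw [← hlast]
    exact (Fin.snoc_init_self g).symm
  refine ⟨m, Fin.init g, p, ⟨?_, fun l => ?_⟩, hp, membershipPattern_injective ?_⟩
  · exact hg.comp (Fin.castSucc_injective m)
  · rw [Finset.nonempty_iff_ne_empty]
    intro h
    rw [← hlast] at h
    exact (Fin.castSucc_lt_last l).ne (hg h)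
  · rw [membershipPattern_unionBlocks _ hp, hh, ← hg']

theorem card_image_membershipPattern {i m n : ℕ} {f : Fin m → Finset (Fin i)}
    {p : Fin (n + 1) → Fin (m + 1)} (hf : IsPrototype i (m + 1) f) (hp : IsBlockOrdered p) :
    (Finset.univ.image
      (membershipPattern fun j => unionBlocks p (transposeSets f j))).card = m + 1 := by
  rw [membershipPattern_unionBlocks f hp, ← Finset.image_image,
    Finset.image_univ_of_surjective hp.surjective,
    Finset.card_image_of_injective _ (snoc_empty_injective hf), Finset.card_univ, Fintype.card_fin]

open Classical in
/-- Tuples without broken circuits correspond to pairs of a functional prototype and a partition. -/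
theorem card_isNBCTuple_eq_sum (i n : ℕ) :
    (Finset.univ.filter (IsNBCTuple (i := i) (m := n))).card =
      ∑ k ∈ Finset.Icc (i + 1) (2 ^ i),
        (Finset.univ.filter (IsFunctional i k)).card * Nat.stirlingSecond (n + 1) k := by
  rw [Finset.card_eq_sum_card_fiberwise
    (f := fun a => (Finset.univ.image (membershipPattern a)).card)
    (t := Finset.Icc (i + 1) (2 ^ i))]
  · refine Finset.sum_congr rfl fun k hk => ?_
    rw [Finset.mem_Icc] at hk
    obtain _ | m := k
    · omega
    have him : i ≤ m := by omega
    rw [← card_isBlockOrdered, ← Finset.card_product]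
    symm
    refine Finset.card_bij (fun q _ => fun j => unionBlocks q.2 (transposeSets q.1 j)) ?_ ?_ ?_
    · rintro ⟨f, p⟩ h
      simp only [Finset.mem_product, Finset.mem_filter, Finset.mem_univ, true_and] at h ⊢
      obtain ⟨hf, hp⟩ := h
      obtain ⟨hf, hnbc⟩ := (isFunctional_succ_iff him f).1 hf
      exact ⟨(isNBCTuple_unionBlocks_iff hp _).2 hnbc, card_image_membershipPattern hf hp⟩
    · rintro ⟨f, p⟩ h ⟨f', p'⟩ h' heq
      simp only [Finset.mem_product, Finset.mem_filter, Finset.mem_univ, true_and] at h h'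
      have heq := congrArg membershipPattern heq
      simp only [membershipPattern_unionBlocks _ h.2, membershipPattern_unionBlocks _ h'.2] at heq
      obtain ⟨h1, rfl⟩ := eq_of_comp_eq_comp (snoc_empty_injective h.1.1)
        (snoc_empty_injective h'.1.1) h.2 h'.2 heq
      rw [(Fin.snoc_injective2 h1).1]
    · intro a ha
      simp only [Finset.mem_filter, Finset.mem_univ, true_and] at ha
      obtain ⟨m', f, p, hf, hp, rfl⟩ := exists_eq_unionBlocks a
      rw [card_image_membershipPattern hf hp] at ha
      obtain rfl : m' = m := by omega
      refine ⟨(f, p), ?_, rfl⟩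
      simp only [Finset.mem_product, Finset.mem_filter, Finset.mem_univ, true_and]
      exact ⟨(isFunctional_succ_iff him f).2 ⟨hf, (isNBCTuple_unionBlocks_iff hp _).1 ha.1⟩, hp⟩
  · intro a ha
    rw [Finset.coe_filter, Set.mem_ofPred_eq] at ha
    rw [Finset.coe_Icc, Set.mem_Icc]
    refine ⟨?_, ?_⟩
    · obtain ⟨m, f, p, hf, hp, rfl⟩ := exists_eq_unionBlocks a
      exact (Nat.succ_le_succ ((isNBCTuple_unionBlocks_iff hp _).1 ha.2).le).trans_eq
        (card_image_membershipPattern hf hp).symm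
    · refine (Finset.card_le_univ _).trans ?_
      simp

theorem theorem1p2 :
    ∃ c : ℕ → ℕ → ℕ,
      (∀ i k : ℕ, i + 1 ≤ k → k ≤ 2 ^ i →
        0 < c i k ∧
        (c i k : ℚ) ≤ (Nat.choose (2 ^ i - 1) (k - 1) : ℚ) * (Nat.factorial (k - 1) : ℚ) /
          (Nat.factorial i : ℚ) ∧
        (c i k : ℚ) = (Nat.card {f : Fin (k - 1) → Finset (Fin i) // IsFunctional i k f} : ℚ) /
          (Nat.factorial i : ℚ)) ∧
      ∀ i n : ℕ, 1 ≤ n →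
        bettiNumber (resonanceArr n) i =
          ∑ k ∈ Finset.Icc (i + 1) (2 ^ i), c i k * Nat.stirlingSecond (n + 1) k := by
  classical
  let F : ℕ → ℕ → ℕ := fun i k => (Finset.univ.filter (IsFunctional i k)).card
  have hF : ∀ i k, Nat.card {f : Fin (k - 1) → Finset (Fin i) // IsFunctional i k f} = F i k :=
    fun i k => by rw [Nat.card_eq_fintype_card, Fintype.card_subtype]
  have hdvd : ∀ i k, i + 1 ≤ k → i.factorial ∣ F i k := by
    intro i k hk
    obtain ⟨m, rfl⟩ := Nat.exists_eq_add_of_le' (Nat.le_of_add_left_le hk)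
    exact factorial_dvd_card_isFunctional (by omega)
  refine ⟨fun i k => F i k / i.factorial, fun i k hk hk2 => ?_, fun i n _ => ?_⟩
  · have hcast : ((F i k / i.factorial : ℕ) : ℚ) = (F i k : ℚ) / (i.factorial : ℚ) :=
      Nat.cast_div (hdvd i k hk) (by exact_mod_cast i.factorial_ne_zero)
    rw [hF, hcast]
    obtain ⟨m, rfl⟩ := Nat.exists_eq_add_of_le' (Nat.le_of_add_left_le hk)
    refine ⟨?_, ?_, rfl⟩
    · obtain ⟨f, hf⟩ := exists_isFunctional (by omega : i ≤ m) hk2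
      exact Nat.div_pos (Nat.le_of_dvd (Finset.card_pos.2 ⟨f, by simpa using hf⟩)
        (hdvd i _ hk)) i.factorial_pos
    · gcongr
      exact_mod_cast card_isFunctional_le i m
  · refine Nat.eq_of_mul_eq_mul_left i.factorial_pos ?_
    rw [← card_isNBCTuple, card_isNBCTuple_eq_sum, Finset.mul_sum]
    refine Finset.sum_congr rfl fun k hk => ?_
    rw [← mul_assoc, Nat.mul_div_cancel' (hdvd i k (Finset.mem_Icc.1 hk).1)]
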